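/- Let \((A,D(A))\) be the generator of a strongly continuous semigroup \((T(t))_{t\ge 0}\) on a real or complex Banach space \(X\), and let \(C:D(A)\to X\) be linear and bounded for the graph norm \(\|x\|_A=\|x\|+\|Ax\|\). Assume that there are \(\varepsilon>0\) and \(q:(0,\varepsilon)\to[0,\infty)\) with \(\lim_{t\searrow 0}q(t)=0\) and \[\int_0^t\|C\,T(s)x\|\,ds\le q(t)\|x\|\qquad\text{for all }x\in D(A),\ 0<t<\varepsilon .\] Let \(V\) be the abstract Volterra operator: for a strongly continuous function \(F:[0,\infty)\to\mathcal L(X)\) and \(t\ge 0\), \((VF)(t)\in\mathcal L(X)\) is the unique bounded operator with \[(VF)(t)x=\int_0^tF(t-s)\,C\,T(s)x\,ds\qquad\text{for all }x\in D(A).\] Then \((A+C,D(A))\) generates a strongly continuous semigroup \((U(t))_{t\ge 0}\) on \(X\). Moreover, let \(\alpha\ge 0\) be such that \(t\mapsto T(t)\in\mathcal L(X)\) is continuous for the operator norm on \((\alpha,\infty)\), and let \(n\in\mathbb N\) (with \(n=0\) allowed, \(V^0T=T\)) be such that \(t\mapsto (V^nT)(t)\) is continuous for the operator norm on \((0,\infty)\).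 Then \(t\mapsto U(t)\) is continuous for the operator norm on \((n\alpha,\infty)\). -/

import Mathlib

open Set Filter Topology

noncomputable section

namespace EvNormCont

/-- `T` restricted to `[0, ∞)` is a strongly continuous (`C₀`-) semigroup of bounded linear
operators on `X`. The values `T t` for `t < 0` play no role. -/
structure IsC0Semigroup {𝕜 X : Type*} [RCLike 𝕜] [NormedAddCommGroup X] [NormedSpace 𝕜 X]
    (T : ℝ → X →L[𝕜] X) : Prop where
  map_zero : T 0 = ContinuousLinearMap.id 𝕜 X
  map_add : ∀ s t : ℝ, 0 ≤ s → 0 ≤ t → T (s + t) = (T s).comp (T t)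
  strong_cont : ∀ x : X, ContinuousOn (fun t : ℝ => T t x) (Ici 0)

/-- The (unbounded, partially defined) operator `A` is the infinitesimal generator of `T`:
`x ∈ D(A)` and `A x = y` hold if and only if `(T h x - x) / h → y` as `h ↘ 0`. -/
def IsGenerator {𝕜 X : Type*} [RCLike 𝕜] [NormedAddCommGroup X] [NormedSpace 𝕜 X]
    [NormedSpace ℝ X] (A : X →ₗ.[𝕜] X) (T : ℝ → X →L[𝕜] X) : Prop :=
  ∀ x y : X, (x, y) ∈ A.graph ↔
    Tendsto (fun h : ℝ => h⁻¹ • (T h x - x)) (𝓝[>] 0) (𝓝 y)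

/-- `C : D(A) → X` is bounded for the graph norm `‖x‖_A = ‖x‖ + ‖A x‖` on `D(A)`. -/
def IsGraphBounded {𝕜 X : Type*} [RCLike 𝕜] [NormedAddCommGroup X] [NormedSpace 𝕜 X]
    (A : X →ₗ.[𝕜] X) (C : A.domain →ₗ[𝕜] X) : Prop :=
  ∃ K : ℝ, ∀ x : A.domain, ‖C x‖ ≤ K * (‖(x : X)‖ + ‖A x‖)

/-- The operator `A + C` with domain `D(A)`. -/
def perturb {𝕜 X : Type*} [RCLike 𝕜] [NormedAddCommGroup X] [NormedSpace 𝕜 X]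
    (A : X →ₗ.[𝕜] X) (C : A.domain →ₗ[𝕜] X) : X →ₗ.[𝕜] X where
  domain := A.domain
  toFun := A.toFun + C

open Classical in
/-- `C` as a function on `X`, with value `0` outside `D(A)`. It is only ever applied to
`T s x` with `s ≥ 0` and `x ∈ D(A)`, and then `T s x ∈ D(A)` when `A` generates `T`. -/
def onDomain {𝕜 X : Type*} [RCLike 𝕜] [NormedAddCommGroup X] [NormedSpace 𝕜 X]
    (A : X →ₗ.[𝕜] X) (C : A.domain →ₗ[𝕜] X) (x : X) : X :=
  if h : x ∈ A.domain then C ⟨x, h⟩ else 0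

open Classical in
/-- The abstract Volterra operator `V` of the perturbation `C`, acting on operator-valued
functions `F`: `(V F)(t)` is the bounded operator on `X` with
`(V F)(t) x = ∫₀ᵗ F(t - s) C T(s) x ds` for all `x ∈ D(A)`.
It is unique as `D(A)` is dense, and under the Miyadera-Voigt condition it exists for all `t ≥ 0`
and all strongly continuous `F`; the default value `0` is used if there is no such operator. -/
def volterra {𝕜 X : Type*} [RCLike 𝕜] [NormedAddCommGroup X] [NormedSpace 𝕜 X]
    [NormedSpace ℝ X] (A : X →ₗ.[𝕜] X) (C : A.domain →ₗ[𝕜] X) (T : ℝ → X →L[𝕜] X)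
    (F : ℝ → X →L[𝕜] X) (t : ℝ) : X →L[𝕜] X :=
  if h : ∃ B : X →L[𝕜] X, ∀ x ∈ A.domain,
      B x = ∫ s in (0 : ℝ)..t, F (t - s) (onDomain A C (T s x))
  then h.choose else 0

end EvNormCont

end

/-!
Let `V` be the Volterra operator of the perturbation `C`. Cutting `[0, ∞)` into short intervals
and summing a geometric series, the Miyadera–Voigt condition becomes the global estimate `∫₀ᵗ
e^{-λs} ‖C T(s) x‖ ds ≤ ‖x‖ / 2` for `x ∈ D(A)` and all large `λ` (`IsMiyadera.exists_weight`).
Hence `V` is a contraction for the norm `sup_t e^{-λt} ‖F(t)‖`, and the Dyson–Phillips series `U =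
∑ₙ Vⁿ T` converges in operator norm, uniformly on bounded intervals, to a solution of `U = T + V
U`. The contraction also gives uniqueness; applied to `U(s + t) - U(t) U(s)` as a function of `s`,
it shows that `U` is a semigroup (`IsMiyadera.isC0Semigroup_dyson`).

Differentiating `U = T + V U` at `0` shows that the generator of `U` extends `A + C`. The same
weighted estimate gives `‖C R(λ, A)‖ ≤ 1/2`, so `λ - A - C = (1 - C R(λ, A)) (λ - A)` is onto, and
as `λ` minus the generator of `U` is injective, the two operators agree
(`IsMiyadera.isGenerator_dyson`). A semigroup is determined by its generator
(`eq_of_isGenerator`), so norm continuity has to be shown for the Dyson–Phillips series only.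

For this, the Volterra integral is split as `V F(t + b) = V (F(· + b))(t) + (V F)(b) T(t)`
(`IsMiyadera.volterra_add`), where `(V F)(b)` is small in norm for small `b`. It follows that `V
F` is norm continuous on `(0, ∞)` if `F` is, and that `V F` is norm continuous on `(β + α, ∞)` if
`F` is so on `(β, ∞)` and `T` on `(α, ∞)`. So `Vᵏ T` is norm continuous on `((k + 1) α, ∞)`, which
contains `(n α, ∞)`, for `k < n`, and on `(0, ∞)` for `k ≥ n`; the sum inherits norm continuity on
`(n α, ∞)`.
-/

open MeasureTheory

set_option linter.unusedSectionVars false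

namespace EvNormCont

variable {𝕜 X : Type*} [RCLike 𝕜] [NormedAddCommGroup X] [NormedSpace 𝕜 X]

/-! ### Strongly continuous operator functions -/

/-- `F` restricted to `[0, ∞)` is continuous for the strong operator topology. -/
def StronglyCont (F : ℝ → X →L[𝕜] X) : Prop :=
  ∀ x : X, ContinuousOn (fun t : ℝ => F t x) (Ici 0)

theorem StronglyCont.exists_bound [CompleteSpace X] {F : ℝ → X →L[𝕜] X} (hF : StronglyCont F)
    (b : ℝ) : ∃ K : ℝ, 0 ≤ K ∧ ∀ t ∈ Icc 0 b, ‖F t‖ ≤ K := by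
  obtain ⟨K, hK⟩ := banach_steinhaus (g := fun t : Icc (0 : ℝ) b => F t) (fun x => by
    obtain ⟨K, hK⟩ := isCompact_Icc.exists_bound_of_continuousOn
      ((hF x).mono (Icc_subset_Ici_self : Icc 0 b ⊆ Ici 0))
    exact ⟨K, fun t => hK t t.2⟩)
  exact ⟨max K 0, le_max_right _ _, fun t ht => (hK ⟨t, ht⟩).trans (le_max_left _ _)⟩

/-- Evaluation of a strongly continuous function is jointly continuous: by the uniform
boundedness principle the function is locally bounded. -/
theorem StronglyCont.tendsto [CompleteSpace X] {F : ℝ → X →L[𝕜] X} (hF : StronglyCont F)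
    {ι : Type*} {l : Filter ι} {f : ι → ℝ} {g : ι → X} {a : ℝ} {x : X}
    (hf : Tendsto f l (𝓝 a)) (hf0 : ∀ᶠ i in l, 0 ≤ f i) (ha : 0 ≤ a)
    (hg : Tendsto g l (𝓝 x)) :
    Tendsto (fun i => F (f i) (g i)) l (𝓝 (F a x)) := by
  obtain ⟨K, hK0, hK⟩ := hF.exists_bound (a + 1)
  have h1 : Tendsto (fun i => F (f i) x) l (𝓝 (F a x)) :=
    (hF x a ha).tendsto.comp (tendsto_nhdsWithin_iff.2 ⟨hf, hf0⟩)
  have h2 : Tendsto (fun i => F (f i) (g i - x)) l (𝓝 0) := by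
    have h3 : Tendsto (fun i => K * ‖g i - x‖) l (𝓝 0) := by
      simpa using (tendsto_iff_norm_sub_tendsto_zero.1 hg).const_mul K
    refine squeeze_zero_norm' ?_ h3
    filter_upwards [hf0, hf.eventually (gt_mem_nhds (lt_add_one a))] with i hi hi'
    exact (F (f i)).le_of_opNorm_le (hK _ ⟨hi, hi'.le⟩) _
  simpa using h2.add h1

theorem StronglyCont.continuousOn_apply [CompleteSpace X] {F : ℝ → X →L[𝕜] X}
    (hF : StronglyCont F) {Y : Type*} [TopologicalSpace Y] {S : Set Y} {f : Y → ℝ} {g : Y → X}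
    (hf : ContinuousOn f S) (hf0 : ∀ y ∈ S, 0 ≤ f y) (hg : ContinuousOn g S) :
    ContinuousOn (fun y => F (f y) (g y)) S := fun y hy =>
  hF.tendsto (hf y hy) (eventually_nhdsWithin_of_forall hf0) (hf0 y hy) (hg y hy)

theorem continuousOn_of_inter_Iic {Y : Type*} [TopologicalSpace Y] {f : ℝ → Y} {S : Set ℝ}
    (h : ∀ b, ContinuousOn f (S ∩ Iic b)) : ContinuousOn f S := fun t ht =>
  (h (t + 1) t ⟨ht, by simp⟩).mono_of_mem_nhdsWithin
    (inter_mem self_mem_nhdsWithin (mem_nhdsWithin_of_mem_nhds (Iic_mem_nhds (by simp))))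

theorem stronglyCont_of_dense {F : ℝ → X →L[𝕜] X} {D : Set X} (hD : Dense D)
    (hb : ∀ b : ℝ, ∃ K : ℝ, ∀ t ∈ Icc 0 b, ‖F t‖ ≤ K)
    (h : ∀ x ∈ D, ContinuousOn (fun t : ℝ => F t x) (Ici 0)) : StronglyCont F := by
  intro x
  refine continuousOn_of_inter_Iic fun b => ?_
  rw [Ici_inter_Iic]
  obtain ⟨K₀, hK₀⟩ := hb b
  obtain ⟨K, hK0, hK⟩ : ∃ K : ℝ, 0 ≤ K ∧ ∀ t ∈ Icc 0 b, ‖F t‖ ≤ K :=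
    ⟨max K₀ 0, le_max_right _ _, fun t ht => (hK₀ t ht).trans (le_max_left _ _)⟩
  refine continuousOn_of_uniform_approx_of_continuousOn fun u hu => ?_
  obtain ⟨ε, hε, hεu⟩ := Metric.mem_uniformity_dist.1 hu
  obtain ⟨y, hy, hxy⟩ := hD.exists_dist_lt x (show 0 < ε / (K + 1) by positivity)
  refine ⟨fun t => F t y, (h y hy).mono Icc_subset_Ici_self, fun s hs => hεu ?_⟩
  rw [dist_eq_norm] at hxy ⊢
  rw [← map_sub]
  calc ‖F s (x - y)‖ ≤ K * ‖x - y‖ := (F s).le_of_opNorm_le (hK s hs) _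
    _ ≤ (K + 1) * ‖x - y‖ := by gcongr; linarith
    _ < (K + 1) * (ε / (K + 1)) := by gcongr
    _ = ε := by field_simp

theorem opNorm_le_of_dense {D : Set X} (hD : Dense D) (B : X →L[𝕜] X)
    {K : ℝ} (hK : 0 ≤ K) (h : ∀ x ∈ D, ‖B x‖ ≤ K * ‖x‖) : ‖B‖ ≤ K := by
  refine B.opNorm_le_bound hK fun x => ?_
  have : IsClosed {x | ‖B x‖ ≤ K * ‖x‖} := isClosed_le (by fun_prop) (by fun_prop)
  exact (this.closure_subset_iff.2 h) (hD x)

theorem eq_of_eqOn_dense {D : Set X} (hD : Dense D) {B B' : X →L[𝕜] X}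
    (h : ∀ x ∈ D, B x = B' x) : B = B' :=
  DFunLike.ext' (Continuous.ext_on hD B.continuous B'.continuous h)

/-- Averages over short intervals `[0, h]` of functions which are close to `y` near `0`. -/
theorem tendsto_average [NormedSpace ℝ X] [CompleteSpace X] {φ : ℝ → ℝ → X} {y : X}
    (hint : ∀ᶠ h in 𝓝[>] (0 : ℝ), IntervalIntegrable (φ h) volume 0 h)
    (hy : ∀ η > 0, ∀ᶠ h in 𝓝[>] (0 : ℝ), ∀ s ∈ Icc 0 h, ‖φ h s - y‖ ≤ η) :
    Tendsto (fun h : ℝ => h⁻¹ • ∫ s in (0 : ℝ)..h, φ h s) (𝓝[>] 0) (𝓝 y) := by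
  rw [Metric.tendsto_nhds]
  intro η hη
  filter_upwards [hint, hy (η / 2) (by positivity), self_mem_nhdsWithin] with h hi hh (h0 : 0 < h)
  have e : h⁻¹ • (∫ s in (0 : ℝ)..h, φ h s) - y = h⁻¹ • ∫ s in (0 : ℝ)..h, (φ h s - y) := by
    rw [intervalIntegral.integral_sub hi intervalIntegrable_const]
    simp [smul_sub, smul_smul, h0.ne']
  rw [dist_eq_norm, e, norm_smul, norm_inv, Real.norm_of_nonneg h0.le]
  have := intervalIntegral.norm_integral_le_of_norm_le_const (a := 0) (b := h)
    (f := fun s => φ h s - y) (C := η / 2) (fun s hs => hh s (by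
      rw [uIoc_of_le h0.le] at hs; exact ⟨hs.1.le, hs.2⟩))
  rw [sub_zero, abs_of_pos h0] at this
  calc h⁻¹ * _ ≤ h⁻¹ * (η / 2 * h) := by gcongr
    _ = η / 2 := by field_simp
    _ < η := by linarith

theorem tendsto_average_of_continuousOn [NormedSpace ℝ X] [CompleteSpace X] {f : ℝ → X}
    (hf : ContinuousOn f (Ici 0)) :
    Tendsto (fun h : ℝ => h⁻¹ • ∫ s in (0 : ℝ)..h, f s) (𝓝[>] 0) (𝓝 (f 0)) := by
  refine tendsto_average (φ := fun _ => f) ?_ fun η hη => ?_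
  · filter_upwards [self_mem_nhdsWithin] with h (h0 : 0 < h)
    exact (hf.mono (by rw [uIcc_of_le h0.le]; exact Icc_subset_Ici_self)).intervalIntegrable
  · obtain ⟨δ, hδ, H⟩ := Metric.continuousOn_iff.1 hf 0 self_mem_Ici η hη
    filter_upwards [Ioo_mem_nhdsGT hδ] with h hh s hs
    have := H s hs.1 (by
      rw [Real.dist_eq, sub_zero, abs_of_nonneg hs.1]; exact hs.2.trans_lt hh.2)
    rw [← dist_eq_norm]; exact this.le

/-! ### Semigroups, generators and resolvents -/

/-- `y` is the value at `x` of the infinitesimal generator of `T`. -/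
def HasGen [NormedSpace ℝ X] (T : ℝ → X →L[𝕜] X) (x y : X) : Prop :=
  Tendsto (fun h : ℝ => h⁻¹ • (T h x - x)) (𝓝[>] 0) (𝓝 y)

theorem IsGenerator.hasGen [NormedSpace ℝ X] {A : X →ₗ.[𝕜] X} {T : ℝ → X →L[𝕜] X}
    (hA : IsGenerator A T) (x : A.domain) : HasGen T x (A x) :=
  (hA _ _).1 (A.mem_graph x)

theorem IsGenerator.exists_of_hasGen [NormedSpace ℝ X] {A : X →ₗ.[𝕜] X} {T : ℝ → X →L[𝕜] X}
    (hA : IsGenerator A T) {x y : X} (h : HasGen T x y) :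
    ∃ hx : x ∈ A.domain, A ⟨x, hx⟩ = y := by
  obtain ⟨z, hz, hz'⟩ := A.mem_graph_iff.1 ((hA x y).2 h)
  subst hz
  exact ⟨z.2, hz'⟩

theorem IsC0Semigroup.stronglyCont {T : ℝ → X →L[𝕜] X} (hT : IsC0Semigroup T) :
    StronglyCont T := hT.strong_cont

theorem IsC0Semigroup.apply_add {T : ℝ → X →L[𝕜] X} (hT : IsC0Semigroup T) {s t : ℝ}
    (hs : 0 ≤ s) (ht : 0 ≤ t) (x : X) : T (s + t) x = T s (T t x) := by
  rw [hT.map_add s t hs ht]; rfl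

theorem IsC0Semigroup.apply_zero {T : ℝ → X →L[𝕜] X} (hT : IsC0Semigroup T) (x : X) :
    T 0 x = x := by
  rw [hT.map_zero]; rfl

theorem IsC0Semigroup.comm {T : ℝ → X →L[𝕜] X} (hT : IsC0Semigroup T) {s t : ℝ}
    (hs : 0 ≤ s) (ht : 0 ≤ t) (x : X) : T s (T t x) = T t (T s x) := by
  rw [← hT.apply_add hs ht, ← hT.apply_add ht hs, add_comm]

/-- The growth constants come from the bound on `[0, 1]` and the semigroup law. -/
theorem IsC0Semigroup.exists_exp_bound [CompleteSpace X] {T : ℝ → X →L[𝕜] X}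
    (hT : IsC0Semigroup T) :
    ∃ M ω : ℝ, 1 ≤ M ∧ 0 ≤ ω ∧ ∀ t, 0 ≤ t → ‖T t‖ ≤ M * Real.exp (ω * t) := by
  obtain ⟨K, -, hK⟩ := hT.stronglyCont.exists_bound 1
  have hM1 : 1 ≤ max K 1 := le_max_right _ _
  have hlog : 0 ≤ Real.log (max K 1) := Real.log_nonneg hM1
  have key : ∀ n : ℕ, ∀ t : ℝ, 0 ≤ t → t ≤ n + 1 → ‖T t‖ ≤ (max K 1) ^ (n + 1) := by
    intro n
    induction n with
    | zero => intro t ht ht'; simpa using Or.inl (hK t ⟨ht, by simpa using ht'⟩)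
    | succ n ih =>
      intro t ht ht'
      rcases le_total t 1 with h1 | h1
      · exact ((hK t ⟨ht, h1⟩).trans (le_max_left _ _)).trans (le_self_pow₀ hM1 (by simp))
      · have e := hT.map_add (t - 1) 1 (by linarith) zero_le_one
        rw [sub_add_cancel] at e
        rw [e, pow_succ]
        refine (ContinuousLinearMap.opNorm_comp_le _ _).trans ?_
        gcongr
        · exact ih (t - 1) (by linarith) (by push_cast at ht'; linarith)
        · exact (hK 1 (by simp)).trans (le_max_left _ _)
  refine ⟨max K 1, Real.log (max K 1), hM1, hlog, fun t ht => ?_⟩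
  have hpos : 0 < max K 1 := by linarith
  calc ‖T t‖ ≤ (max K 1) ^ (⌊t⌋₊ + 1) := key _ t ht (Nat.lt_floor_add_one t).le
    _ = max K 1 * Real.exp (Real.log (max K 1) * ⌊t⌋₊) := by
      rw [mul_comm (Real.log _), Real.exp_nat_mul, Real.exp_log hpos, pow_succ, mul_comm]
    _ ≤ _ := by
      gcongr
      exact Nat.floor_le ht

variable [NormedSpace ℝ X] [IsScalarTower ℝ 𝕜 X] [CompleteSpace X]

theorem integrableOn_exp_smul_orbit {T : ℝ → X →L[𝕜] X} (hT : IsC0Semigroup T) {M ω lam : ℝ}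
    (hM : ∀ t, 0 ≤ t → ‖T t‖ ≤ M * Real.exp (ω * t)) (hlam : ω < lam) (x : X) :
    IntegrableOn (fun s : ℝ => Real.exp (-(lam * s)) • T s x) (Ioi 0) := by
  have hc : ContinuousOn (fun s : ℝ => Real.exp (-(lam * s)) • T s x) (Ioi 0) :=
    ContinuousOn.smul (by fun_prop) ((hT.strong_cont x).mono Ioi_subset_Ici_self)
  refine Integrable.mono' (((exp_neg_integrableOn_Ioi 0 (sub_pos.2 hlam))).const_mul (M * ‖x‖))
    (hc.aestronglyMeasurable measurableSet_Ioi)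
    (ae_restrict_of_forall_mem measurableSet_Ioi fun s hs => ?_)
  rw [norm_smul, Real.norm_of_nonneg (Real.exp_pos _).le]
  calc _ ≤ Real.exp (-(lam * s)) * (M * Real.exp (ω * s) * ‖x‖) := by
        gcongr; exact (T s).le_of_opNorm_le (hM s (le_of_lt hs)) x
    _ = M * ‖x‖ * (Real.exp (-(lam * s)) * Real.exp (ω * s)) := by ring
    _ = _ := by rw [← Real.exp_add]; congr 2; ring

/-- For large `λ` the Laplace transform `x ↦ ∫₀^∞ e^{-λs} T(s) x ds` is a bounded two-sided inverse
of `λ - A`, where `A` is the generator of `T`. -/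
theorem exists_resolvent {T : ℝ → X →L[𝕜] X} (hT : IsC0Semigroup T) {M ω lam : ℝ}
    (hM : ∀ t, 0 ≤ t → ‖T t‖ ≤ M * Real.exp (ω * t)) (hlam : ω < lam) :
    ∃ R : X →L[𝕜] X,
      (∀ x, R x = ∫ s in Ioi (0 : ℝ), Real.exp (-(lam * s)) • T s x) ∧
      (∀ x, HasGen T (R x) (lam • R x - x)) ∧
      (∀ x y, HasGen T x y → R (lam • x - y) = x) ∧
      (∀ t, 0 ≤ t → ∀ x, R (T t x) = T t (R x)) := by
  have hint := fun x => integrableOn_exp_smul_orbit hT hM hlam x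
  have hcont : ∀ x, ContinuousOn (fun s : ℝ => Real.exp (-(lam * s)) • T s x) (Ici 0) := fun x =>
    ContinuousOn.smul (by fun_prop) (hT.strong_cont x)
  let L : X →ₗ[𝕜] X :=
    { toFun := fun x => ∫ s in Ioi (0 : ℝ), Real.exp (-(lam * s)) • T s x
      map_add' := fun x y => by
        rw [← integral_add (hint x) (hint y)]
        simp [smul_add]
      map_smul' := fun c x => by
        rw [RingHom.id_apply, ← integral_smul]
        refine integral_congr_ae (Eventually.of_forall fun s => ?_)
        simp only [map_smul]
        exact smul_comm _ _ _ }
  have hL : ∃ K, ∀ x, ‖L x‖ ≤ K * ‖x‖ := by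
    refine ⟨∫ s in Ioi (0 : ℝ), M * Real.exp (-(lam - ω) * s), fun x => ?_⟩
    rw [← integral_mul_const]
    refine norm_integral_le_of_norm_le
      ((((exp_neg_integrableOn_Ioi 0 (sub_pos.2 hlam))).const_mul M).mul_const _)
      (ae_restrict_of_forall_mem measurableSet_Ioi fun s hs => ?_)
    rw [norm_smul, Real.norm_of_nonneg (Real.exp_pos _).le]
    calc _ ≤ Real.exp (-(lam * s)) * (M * Real.exp (ω * s) * ‖x‖) := by
          gcongr; exact (T s).le_of_opNorm_le (hM s (le_of_lt hs)) x
      _ = M * (Real.exp (-(lam * s)) * Real.exp (ω * s)) * ‖x‖ := by ring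
      _ = _ := by rw [← Real.exp_add]; congr 3; ring
  set R : X →L[𝕜] X := L.mkContinuousOfExistsBound hL with hR
  have hRx : ∀ x, R x = ∫ s in Ioi (0 : ℝ), Real.exp (-(lam * s)) • T s x := fun x => rfl
  have hcomm : ∀ t, 0 ≤ t → ∀ x, R (T t x) = T t (R x) := by
    intro t ht x
    rw [hRx, hRx, ← ContinuousLinearMap.integral_comp_comm _ (hint x)]
    refine setIntegral_congr_fun measurableSet_Ioi fun s hs => ?_
    simp only [ContinuousLinearMap.map_smul_of_tower]
    rw [hT.comm ht (le_of_lt hs)]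
  -- `T(h) R x = e^{λh} ∫_h^∞ e^{-λs} T(s) x ds`
  have hshift : ∀ h, 0 ≤ h → ∀ x, T h (R x) =
      Real.exp (lam * h) • (R x - ∫ s in (0 : ℝ)..h, Real.exp (-(lam * s)) • T s x) := by
    intro h h0 x
    have e1 := intervalIntegral.integral_interval_add_Ioi (hint x)
      ((hint x).mono_set (Ioi_subset_Ioi h0))
    rw [← hRx] at e1
    rw [← e1, add_sub_cancel_left, e1]
    have e2 := (measurePreserving_add_right (volume : Measure ℝ) h).setIntegral_preimage_emb
      (measurableEmbedding_addRight h) (fun s => Real.exp (-(lam * s)) • T s x) (Ioi h)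
    rw [← e2, ← hcomm h h0, hRx, ← integral_smul]
    have e3 : (fun x => x + h) ⁻¹' Ioi h = Ioi 0 := by
      ext s; simp
    rw [e3]
    refine setIntegral_congr_fun measurableSet_Ioi fun s hs => ?_
    rw [smul_smul, ← Real.exp_add, hT.apply_add (le_of_lt hs) h0]
    congr 2; ring
  have hgen : ∀ x, HasGen T (R x) (lam • R x - x) := by
    intro x
    have h1 : Tendsto (fun h : ℝ => h⁻¹ * (Real.exp (lam * h) - 1)) (𝓝[>] 0) (𝓝 lam) := by
      have : HasDerivAt (fun h : ℝ => Real.exp (lam * h)) lam 0 := by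
        simpa using ((hasDerivAt_id (0 : ℝ)).const_mul lam).exp
      have := (hasDerivAt_iff_tendsto_slope_zero.1 this).mono_left
        (nhdsWithin_mono (0 : ℝ) (fun s hs => ne_of_gt hs : Ioi (0 : ℝ) ⊆ {0}ᶜ))
      simpa using this
    have h2 := tendsto_average_of_continuousOn (hcont x)
    simp only [mul_zero, neg_zero, Real.exp_zero, one_smul, hT.apply_zero] at h2
    have h3 : Tendsto (fun h : ℝ => Real.exp (lam * h)) (𝓝[>] 0) (𝓝 1) := by
      have : Continuous (fun h : ℝ => Real.exp (lam * h)) := by fun_prop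
      simpa using (this.tendsto 0).mono_left nhdsWithin_le_nhds
    have h4 := (h1.smul_const (R x)).sub (h3.smul h2)
    rw [one_smul] at h4
    refine h4.congr' ?_
    filter_upwards [self_mem_nhdsWithin] with h (h0 : 0 < h)
    rw [hshift h h0.le, smul_sub, mul_smul, sub_smul, one_smul, smul_comm _ h⁻¹, ← smul_sub,
      smul_sub (Real.exp _), ← smul_sub]
    congr 1
    abel
  refine ⟨R, hRx, hgen, fun x y hxy => ?_, hcomm⟩
  -- `R` commutes with the difference quotients, hence with the generator
  have h1 : Tendsto (fun h : ℝ => h⁻¹ • (T h (R x) - R x)) (𝓝[>] 0) (𝓝 (R y)) := by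
    refine ((R.continuous.tendsto y).comp hxy).congr' ?_
    filter_upwards [self_mem_nhdsWithin] with h (h0 : 0 < h)
    simp only [Function.comp_apply, ContinuousLinearMap.map_smul_of_tower, map_sub,
      hcomm h h0.le]
  have := tendsto_nhds_unique h1 (hgen x)
  rw [map_sub, this, ContinuousLinearMap.map_smul_of_tower]
  abel

theorem HasGen.apply {T : ℝ → X →L[𝕜] X} (hT : IsC0Semigroup T) {x y : X} (h : HasGen T x y)
    {t : ℝ} (ht : 0 ≤ t) : HasGen T (T t x) (T t y) := by
  refine (((T t).continuous.tendsto y).comp h).congr' ?_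
  filter_upwards [self_mem_nhdsWithin] with s (hs : 0 < s)
  simp only [Function.comp_apply, ContinuousLinearMap.map_smul_of_tower, map_sub, hT.comm ht hs.le]

/-- The averages `h⁻¹ ∫₀ʰ T(s) x ds` lie in the domain and tend to `x`. -/
theorem IsGenerator.dense_domain {T : ℝ → X →L[𝕜] X} (hT : IsC0Semigroup T)
    {A : X →ₗ.[𝕜] X} (hA : IsGenerator A T) : Dense (A.domain : Set X) := by
  intro x
  have hint : ∀ a b : ℝ, 0 ≤ a → 0 ≤ b → IntervalIntegrable (fun s => T s x) volume a b :=
    fun a b ha hb =>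
      ((hT.strong_cont x).mono fun s hs => (le_min ha hb).trans hs.1).intervalIntegrable
  have hav := tendsto_average_of_continuousOn (hT.strong_cont x)
  simp only [hT.apply_zero] at hav
  refine mem_closure_of_tendsto hav ?_
  filter_upwards [self_mem_nhdsWithin] with h (h0 : 0 < h)
  have hg : HasGen T (∫ s in (0 : ℝ)..h, T s x) (T h x - x) := by
    have h1 := (((T h).continuous.tendsto _).comp hav).sub hav
    refine h1.congr' ?_
    filter_upwards [self_mem_nhdsWithin] with r (hr : 0 < r)
    have e : ∀ a b : ℝ, 0 ≤ a → 0 ≤ b →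
        T a (∫ s in (0 : ℝ)..b, T s x) = ∫ s in a..(b + a), T s x := by
      intro a b ha hb
      have e1 := intervalIntegral.integral_comp_add_right (a := 0) (b := b) (fun s => T s x) a
      rw [zero_add] at e1
      rw [← ContinuousLinearMap.intervalIntegral_comp_comm _ (hint 0 b le_rfl hb), ← e1]
      refine intervalIntegral.integral_congr fun s hs => ?_
      rw [uIcc_of_le hb] at hs
      rw [add_comm, hT.apply_add ha hs.1]
    simp only [Function.comp_apply, ContinuousLinearMap.map_smul_of_tower]
    rw [← smul_sub, e h r h0.le hr.le, e r h hr.le h0.le]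
    congr 1
    rw [sub_eq_sub_iff_add_eq_add, add_comm r h,
      add_comm (∫ s in h..(h + r), T s x), add_comm (∫ s in r..(h + r), T s x),
      intervalIntegral.integral_add_adjacent_intervals (hint _ _ le_rfl h0.le)
        (hint _ _ h0.le (by linarith)),
      intervalIntegral.integral_add_adjacent_intervals (hint _ _ le_rfl hr.le)
        (hint _ _ hr.le (by linarith))]
  obtain ⟨hx, -⟩ := hA.exists_of_hasGen hg
  rw [SetLike.mem_coe, ← algebraMap_smul 𝕜 h⁻¹]
  exact A.domain.smul_mem _ hx

/-- A generator determines its semigroup: for `x` in its domain, `s ↦ S(t - s) U(s) x` has right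
derivative zero on `[0, t)`, and it joins `S(t) x` to `U(t) x`. -/
theorem eq_of_isGenerator {S U : ℝ → X →L[𝕜] X} (hS : IsC0Semigroup S) (hU : IsC0Semigroup U)
    {B : X →ₗ.[𝕜] X} (hBS : IsGenerator B S) (hBU : IsGenerator B U) {t : ℝ} (ht : 0 ≤ t) :
    S t = U t := by
  refine eq_of_eqOn_dense (hBS.dense_domain hS) fun x hx => ?_
  have hgen := hBU.hasGen ⟨x, hx⟩
  have key := constant_of_has_deriv_right_zero (f := fun s => S (t - s) (U s x)) (a := 0) (b := t)
    (hS.stronglyCont.continuousOn_apply (by fun_prop) (fun s hs => sub_nonneg.2 hs.2)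
      ((hU.strong_cont x).mono Icc_subset_Ici_self)) ?_ t ⟨ht, le_rfl⟩
  · simpa [hS.apply_zero, hU.apply_zero] using key.symm
  intro s hs
  obtain ⟨hz, hBz⟩ := hBU.exists_of_hasGen (hgen.apply hU hs.1)
  have hgS := hBS.hasGen ⟨_, hz⟩
  rw [hBz] at hgS
  have hgU := hgen.apply hU hs.1
  have hdiff : Tendsto (fun h : ℝ => h⁻¹ • (U h (U s x) - S h (U s x))) (𝓝[>] 0) (𝓝 0) := by
    have := hgU.sub hgS
    rw [sub_self] at this
    refine this.congr fun h => ?_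
    rw [← smul_sub]; congr 1; abel
  have hlim := hS.stronglyCont.tendsto (l := 𝓝[>] (0 : ℝ)) (f := fun h => t - s - h)
    (a := t - s) (by
      have : Continuous fun h : ℝ => t - s - h := by fun_prop
      simpa using (this.tendsto 0).mono_left nhdsWithin_le_nhds) (by
      filter_upwards [Ioo_mem_nhdsGT (sub_pos.2 hs.2)] with h hh
      linarith [hh.2]) (by linarith [hs.2]) hdiff
  rw [map_zero] at hlim
  rw [hasDerivWithinAt_iff_tendsto_slope, Ici_sdiff_left]
  have hmap : Tendsto (fun r : ℝ => r - s) (𝓝[>] s) (𝓝[>] 0) := by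
    refine tendsto_nhdsWithin_iff.2 ⟨?_, ?_⟩
    · have : Continuous fun r : ℝ => r - s := by fun_prop
      simpa using (this.tendsto s).mono_left nhdsWithin_le_nhds
    · filter_upwards [self_mem_nhdsWithin] with r (hr : s < r)
      exact sub_pos.2 hr
  refine (hlim.comp hmap).congr' ?_
  filter_upwards [Ioo_mem_nhdsGT hs.2] with r hr
  have e1 : U r x = U (r - s) (U s x) := by
    rw [← hU.apply_add (by linarith [hr.1]) hs.1, sub_add_cancel]
  have e2 : S (t - s) (U s x) = S (t - r) (S (r - s) (U s x)) := by
    rw [← hS.apply_add (by linarith [hr.2]) (by linarith [hr.1])]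
    congr 2; ring
  simp only [Function.comp_apply, slope, vsub_eq_sub]
  rw [e1, e2, ← map_sub, ← ContinuousLinearMap.map_smul_of_tower]
  congr 2; ring

/-! ### Miyadera–Voigt perturbations -/

/-- `C` is a perturbation of the generator `A` of the semigroup `T` which is bounded for the graph
norm and satisfies the Miyadera–Voigt condition with arbitrarily small constants. -/
structure IsMiyadera (T : ℝ → X →L[𝕜] X) (A : X →ₗ.[𝕜] X) (C : A.domain →ₗ[𝕜] X) : Prop where
  semigroup : IsC0Semigroup T
  generator : IsGenerator A T
  graphBounded : IsGraphBounded A C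
  small : ∀ η : ℝ, 0 < η → ∃ h : ℝ, 0 < h ∧ ∀ x ∈ A.domain,
    (∫ s in (0 : ℝ)..h, ‖onDomain A C (T s x)‖) ≤ η * ‖x‖

theorem onDomain_of_mem (A : X →ₗ.[𝕜] X) (C : A.domain →ₗ[𝕜] X) {x : X} (hx : x ∈ A.domain) :
    onDomain A C x = C ⟨x, hx⟩ := dif_pos hx

theorem onDomain_add (A : X →ₗ.[𝕜] X) (C : A.domain →ₗ[𝕜] X) {x y : X} (hx : x ∈ A.domain)
    (hy : y ∈ A.domain) : onDomain A C (x + y) = onDomain A C x + onDomain A C y := by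
  rw [onDomain_of_mem A C hx, onDomain_of_mem A C hy,
    onDomain_of_mem A C (A.domain.add_mem hx hy), ← map_add]
  rfl

theorem onDomain_smul (A : X →ₗ.[𝕜] X) (C : A.domain →ₗ[𝕜] X) {x : X} (hx : x ∈ A.domain)
    (c : 𝕜) : onDomain A C (c • x) = c • onDomain A C x := by
  rw [onDomain_of_mem A C hx, onDomain_of_mem A C (A.domain.smul_mem c hx), ← map_smul]
  rfl

namespace IsMiyadera

variable {T : ℝ → X →L[𝕜] X} {A : X →ₗ.[𝕜] X} {C : A.domain →ₗ[𝕜] X}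

theorem dense (h : IsMiyadera T A C) : Dense (A.domain : Set X) :=
  h.generator.dense_domain h.semigroup

theorem apply_mem (h : IsMiyadera T A C) {x : X} (hx : x ∈ A.domain) {s : ℝ} (hs : 0 ≤ s) :
    T s x ∈ A.domain :=
  (h.generator.exists_of_hasGen ((h.generator.hasGen ⟨x, hx⟩).apply h.semigroup hs)).1

/-- `C R(λ, A)` is a bounded operator. -/
theorem exists_comp_resolvent (h : IsMiyadera T A C) {R : X →L[𝕜] X} {lam : ℝ}
    (hR : ∀ x, HasGen T (R x) (lam • R x - x)) :
    ∃ P : X →L[𝕜] X, ∀ x, P x = onDomain A C (R x) := by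
  obtain ⟨K, hK⟩ := h.graphBounded
  have hmem : ∀ x, R x ∈ A.domain := fun x => (h.generator.exists_of_hasGen (hR x)).1
  let L : X →ₗ[𝕜] X := C.comp ((R : X →ₗ[𝕜] X).codRestrict A.domain hmem)
  have hL : ∀ x, L x = onDomain A C (R x) := fun x => (onDomain_of_mem A C (hmem x)).symm
  refine ⟨L.mkContinuous (|K| * (‖R‖ + (|lam| * ‖R‖ + 1))) fun x => ?_, hL⟩
  obtain ⟨hx, hAx⟩ := h.generator.exists_of_hasGen (hR x)
  have h1 := hK ⟨R x, hx⟩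
  rw [hAx] at h1
  have h2 : ‖R x‖ ≤ ‖R‖ * ‖x‖ := R.le_opNorm x
  have h3 : ‖lam • R x - x‖ ≤ |lam| * (‖R‖ * ‖x‖) + ‖x‖ := by
    refine (norm_sub_le _ _).trans ?_
    rw [norm_smul, Real.norm_eq_abs]
    gcongr
  calc ‖L x‖ ≤ K * (‖R x‖ + ‖lam • R x - x‖) := h1
    _ ≤ |K| * (‖R x‖ + ‖lam • R x - x‖) := by gcongr; exact le_abs_self K
    _ ≤ |K| * (‖R‖ * ‖x‖ + (|lam| * (‖R‖ * ‖x‖) + ‖x‖)) := by gcongr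
    _ = _ := by ring

/-- For `x ∈ D(A)` the function `s ↦ C T(s) x` is continuous, since
`C T(s) x = C R(λ, A) T(s) (λ - A) x`. -/
theorem continuousOn_orbit (h : IsMiyadera T A C) {x : X} (hx : x ∈ A.domain) :
    ContinuousOn (fun s => onDomain A C (T s x)) (Ici 0) := by
  obtain ⟨M, ω, -, -, hM⟩ := h.semigroup.exists_exp_bound
  obtain ⟨R, -, hR1, hR2, hR3⟩ := exists_resolvent h.semigroup hM (lt_add_one ω)
  obtain ⟨P, hP⟩ := h.exists_comp_resolvent hR1
  have e := hR2 x _ (h.generator.hasGen ⟨x, hx⟩)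
  set z := (ω + 1) • x - A ⟨x, hx⟩
  refine (P.continuous.comp_continuousOn (h.semigroup.strong_cont z)).congr fun s hs => ?_
  simp only [Function.comp_apply]
  rw [hP, hR3 s hs, e]

theorem intervalIntegrable_norm_orbit (h : IsMiyadera T A C) {x : X} (hx : x ∈ A.domain)
    {a b : ℝ} (ha : 0 ≤ a) (hb : 0 ≤ b) :
    IntervalIntegrable (fun s => ‖onDomain A C (T s x)‖) volume a b :=
  ((h.continuousOn_orbit hx).norm.mono fun _ hs => (le_min ha hb).trans hs.1).intervalIntegrable

theorem orbit_add (h : IsMiyadera T A C) (x : X) {s a : ℝ} (hs : 0 ≤ s) (ha : 0 ≤ a) :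
    onDomain A C (T (s + a) x) = onDomain A C (T s (T a x)) := by
  rw [h.semigroup.apply_add hs ha]

theorem integral_norm_orbit_shift (h : IsMiyadera T A C) (x : X) {a b : ℝ} (ha : 0 ≤ a)
    (hb : 0 ≤ b) : (∫ s in a..(a + b), ‖onDomain A C (T s x)‖) =
      ∫ s in (0 : ℝ)..b, ‖onDomain A C (T s (T a x))‖ := by
  have e1 := intervalIntegral.integral_comp_add_right (a := 0) (b := b)
    (fun s => ‖onDomain A C (T s x)‖) a
  rw [zero_add, add_comm b a] at e1
  rw [← e1]
  refine intervalIntegral.integral_congr fun s hs => ?_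
  rw [uIcc_of_le hb] at hs
  rw [h.orbit_add x hs.1 ha]

/-- With an exponential weight `e^{-λs}`, the Miyadera–Voigt condition holds on the whole half-line
with constant `1/2`: cut `[0, ∞)` into intervals of a fixed length `h` and sum a geometric
series. -/
theorem exists_weight (h : IsMiyadera T A C) :
    ∃ M ω lam₀ : ℝ, 1 ≤ M ∧ 0 ≤ ω ∧ ω < lam₀ ∧
      (∀ t, 0 ≤ t → ‖T t‖ ≤ M * Real.exp (ω * t)) ∧
      ∀ lam, lam₀ ≤ lam → ∀ x ∈ A.domain, ∀ t, 0 ≤ t →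
        (∫ s in (0 : ℝ)..t, Real.exp (-(lam * s)) * ‖onDomain A C (T s x)‖) ≤ 1 / 2 * ‖x‖ := by
  obtain ⟨M, ω, hM1, hω, hM⟩ := h.semigroup.exists_exp_bound
  have hM0 : 0 < M := by linarith
  obtain ⟨r, hr, hsmall⟩ := h.small (1 / (4 * M)) (by positivity)
  -- `λ₀` is chosen so that `e^{-(λ₀ - ω) r} = 1/2`
  refine ⟨M, ω, ω + Real.log 2 / r, hM1, hω,
    lt_add_of_pos_right _ (div_pos (Real.log_pos one_lt_two) hr), hM, fun lam hlam x hx t ht => ?_⟩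
  have hlam0 : 0 ≤ lam := by
    have : 0 < Real.log 2 / r := div_pos (Real.log_pos one_lt_two) hr
    linarith
  have hcont : ContinuousOn (fun s => Real.exp (-(lam * s)) * ‖onDomain A C (T s x)‖) (Ici 0) :=
    ContinuousOn.mul (by fun_prop) (h.continuousOn_orbit hx).norm
  have hii : ∀ a b : ℝ, 0 ≤ a → 0 ≤ b → IntervalIntegrable
      (fun s => Real.exp (-(lam * s)) * ‖onDomain A C (T s x)‖) volume a b := fun a b ha hb =>
    (hcont.mono fun _ hs => (le_min ha hb).trans hs.1).intervalIntegrable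
  have hq : Real.exp (-((lam - ω) * r)) ≤ 1 / 2 := by
    rw [one_div, ← Real.exp_log (show (0 : ℝ) < 2 by norm_num), ← Real.exp_neg, Real.exp_le_exp,
      neg_le_neg_iff]
    have : Real.log 2 / r ≤ lam - ω := by linarith
    exact (div_le_iff₀ hr).1 this
  have piece : ∀ j : ℕ, (∫ s in ((j : ℝ) * r)..((j + 1 : ℕ) * r),
      Real.exp (-(lam * s)) * ‖onDomain A C (T s x)‖) ≤ (1 / 2 : ℝ) ^ j * (1 / 4 * ‖x‖) := by
    intro j
    have hj : 0 ≤ (j : ℝ) * r := by positivity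
    have ej : ((j + 1 : ℕ) : ℝ) * r = j * r + r := by push_cast; ring
    rw [ej]
    calc (∫ s in ((j : ℝ) * r)..(j * r + r),
          Real.exp (-(lam * s)) * ‖onDomain A C (T s x)‖)
        ≤ ∫ s in ((j : ℝ) * r)..(j * r + r),
          Real.exp (-(lam * (j * r))) * ‖onDomain A C (T s x)‖ := by
          refine intervalIntegral.integral_mono_on (by linarith) (hii _ _ hj (by positivity))
            ((h.intervalIntegrable_norm_orbit hx hj (by positivity)).const_mul _) fun s hs => ?_
          gcongr
          exact hs.1
      _ = Real.exp (-(lam * (j * r))) *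
          ∫ s in (0 : ℝ)..r, ‖onDomain A C (T s (T (j * r) x))‖ := by
          rw [intervalIntegral.integral_const_mul, h.integral_norm_orbit_shift x hj hr.le]
      _ ≤ Real.exp (-(lam * (j * r))) * (1 / (4 * M) * (M * Real.exp (ω * (j * r)) * ‖x‖)) := by
          gcongr
          refine (hsmall _ (h.apply_mem hx hj)).trans ?_
          gcongr
          exact (T _).le_of_opNorm_le (hM _ hj) x
      _ = (Real.exp (-(lam * (j * r))) * Real.exp (ω * (j * r))) * (1 / 4 * ‖x‖) := by
          field_simp
      _ = (Real.exp (-((lam - ω) * r))) ^ j * (1 / 4 * ‖x‖) := by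
          rw [← Real.exp_add, ← Real.exp_nat_mul]
          congr 2; ring
      _ ≤ _ := by gcongr
  obtain ⟨N, hN⟩ := exists_nat_ge (t / r)
  have hN' : t ≤ N * r := (div_le_iff₀ hr).1 hN
  calc (∫ s in (0 : ℝ)..t, Real.exp (-(lam * s)) * ‖onDomain A C (T s x)‖)
      ≤ ∫ s in (0 : ℝ)..(N * r), Real.exp (-(lam * s)) * ‖onDomain A C (T s x)‖ := by
        refine intervalIntegral.integral_mono_interval le_rfl ht hN'
          (Eventually.of_forall fun s => by positivity) (hii _ _ le_rfl (by positivity))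
    _ = ∑ j ∈ Finset.range N, ∫ s in ((j : ℝ) * r)..((j + 1 : ℕ) * r),
          Real.exp (-(lam * s)) * ‖onDomain A C (T s x)‖ := by
        rw [intervalIntegral.sum_integral_adjacent_intervals (a := fun j : ℕ => (j : ℝ) * r)
          (fun j _ => hii _ _ (by positivity) (by positivity))]
        simp
    _ ≤ ∑ j ∈ Finset.range N, (1 / 2 : ℝ) ^ j * (1 / 4 * ‖x‖) :=
        Finset.sum_le_sum fun j _ => piece j
    _ = (∑ j ∈ Finset.range N, (1 / 2 : ℝ) ^ j) * (1 / 4 * ‖x‖) := by rw [Finset.sum_mul]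
    _ ≤ 2 * (1 / 4 * ‖x‖) := by gcongr; exact sum_geometric_two_le N
    _ = 1 / 2 * ‖x‖ := by ring

theorem exists_integral_bound (h : IsMiyadera T A C) (b : ℝ) :
    ∃ L : ℝ, 0 ≤ L ∧ ∀ x ∈ A.domain, ∀ t ∈ Icc 0 b,
      (∫ s in (0 : ℝ)..t, ‖onDomain A C (T s x)‖) ≤ L * ‖x‖ := by
  obtain ⟨M, ω, lam, -, hω, hlam, -, hw⟩ := h.exists_weight
  refine ⟨Real.exp (lam * b) * (1 / 2), by positivity, fun x hx t ht => ?_⟩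
  have hcont : ContinuousOn (fun s => Real.exp (-(lam * s)) * ‖onDomain A C (T s x)‖) (Icc 0 t) :=
    ContinuousOn.mul (by fun_prop) ((h.continuousOn_orbit hx).norm.mono Icc_subset_Ici_self)
  calc (∫ s in (0 : ℝ)..t, ‖onDomain A C (T s x)‖)
      ≤ ∫ s in (0 : ℝ)..t, Real.exp (lam * b) *
          (Real.exp (-(lam * s)) * ‖onDomain A C (T s x)‖) := by
        refine intervalIntegral.integral_mono_on ht.1
          (h.intervalIntegrable_norm_orbit hx le_rfl ht.1)
          ((hcont.intervalIntegrable_of_Icc ht.1).const_mul _) fun s hs => ?_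
        rw [← mul_assoc, ← Real.exp_add]
        refine le_mul_of_one_le_left (norm_nonneg _) (Real.one_le_exp ?_)
        have : lam * s ≤ lam * b := by
          gcongr
          · linarith
          · exact hs.2.trans ht.2
        linarith
    _ = Real.exp (lam * b) * ∫ s in (0 : ℝ)..t,
          Real.exp (-(lam * s)) * ‖onDomain A C (T s x)‖ := by
        rw [intervalIntegral.integral_const_mul]
    _ ≤ Real.exp (lam * b) * (1 / 2 * ‖x‖) := by gcongr; exact hw lam le_rfl x hx t ht.1
    _ = _ := by ring

/-! ### The abstract Volterra operator -/

variable {F G : ℝ → X →L[𝕜] X}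

theorem continuousOn_integrand (h : IsMiyadera T A C) (hF : StronglyCont F) (t : ℝ) {x : X}
    (hx : x ∈ A.domain) :
    ContinuousOn (fun s => F (t - s) (onDomain A C (T s x))) (Icc 0 t) :=
  hF.continuousOn_apply (by fun_prop) (fun _ hs => sub_nonneg.2 hs.2)
    ((h.continuousOn_orbit hx).mono Icc_subset_Ici_self)

theorem intervalIntegrable_integrand (h : IsMiyadera T A C) (hF : StronglyCont F) {t : ℝ}
    (ht : 0 ≤ t) {x : X} (hx : x ∈ A.domain) :
    IntervalIntegrable (fun s => F (t - s) (onDomain A C (T s x))) volume 0 t :=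
  (h.continuousOn_integrand hF t hx).intervalIntegrable_of_Icc ht

theorem norm_integral_le (h : IsMiyadera T A C) {t : ℝ} (ht : 0 ≤ t)
    {x : X} (hx : x ∈ A.domain) {w : ℝ → ℝ} (hw : ContinuousOn w (Icc 0 t))
    (hFw : ∀ s ∈ Icc 0 t, ‖F (t - s)‖ ≤ w s) :
    ‖∫ s in (0 : ℝ)..t, F (t - s) (onDomain A C (T s x))‖ ≤
      ∫ s in (0 : ℝ)..t, w s * ‖onDomain A C (T s x)‖ := by
  refine intervalIntegral.norm_integral_le_of_norm_le ht
    (Eventually.of_forall fun s hs => ?_)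
    ((hw.mul ((h.continuousOn_orbit hx).norm.mono
      Icc_subset_Ici_self)).intervalIntegrable_of_Icc ht)
  exact (F _).le_of_opNorm_le (hFw s ⟨hs.1.le, hs.2⟩) _

/-- The bounded operator defining `(V F)(t)` exists, so `volterra` does not take its default
value. -/
theorem volterra_apply (h : IsMiyadera T A C) (hF : StronglyCont F) {t : ℝ} (ht : 0 ≤ t) {x : X}
    (hx : x ∈ A.domain) :
    volterra A C T F t x = ∫ s in (0 : ℝ)..t, F (t - s) (onDomain A C (T s x)) := by
  have hex : ∃ B : X →L[𝕜] X, ∀ x ∈ A.domain,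
      B x = ∫ s in (0 : ℝ)..t, F (t - s) (onDomain A C (T s x)) := by
    obtain ⟨K, hK0, hK⟩ := hF.exists_bound t
    obtain ⟨L, hL0, hL⟩ := h.exists_integral_bound t
    let Φ : A.domain →ₗ[𝕜] X :=
      { toFun := fun x => ∫ s in (0 : ℝ)..t, F (t - s) (onDomain A C (T s x))
        map_add' := fun x y => by
          rw [← intervalIntegral.integral_add (h.intervalIntegrable_integrand hF ht x.2)
            (h.intervalIntegrable_integrand hF ht y.2)]
          refine intervalIntegral.integral_congr fun s hs => ?_
          rw [uIcc_of_le ht] at hs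
          simp only [Submodule.coe_add, map_add]
          rw [onDomain_add A C (h.apply_mem x.2 hs.1) (h.apply_mem y.2 hs.1), map_add]
        map_smul' := fun c x => by
          rw [RingHom.id_apply, ← intervalIntegral.integral_smul]
          refine intervalIntegral.integral_congr fun s hs => ?_
          rw [uIcc_of_le ht] at hs
          simp only [Submodule.coe_smul, map_smul]
          rw [onDomain_smul A C (h.apply_mem x.2 hs.1), map_smul] }
    have hΦ : ∀ x : A.domain, ‖Φ x‖ ≤ K * L * ‖A.domain.subtypeL x‖ := fun x => by
      refine (h.norm_integral_le ht x.2 (w := fun _ => K) continuousOn_const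
        (fun s hs => hK _ ⟨sub_nonneg.2 hs.2, by linarith [hs.1]⟩)).trans ?_
      rw [intervalIntegral.integral_const_mul, mul_assoc]
      gcongr
      exact hL _ x.2 t ⟨ht, le_rfl⟩
    have hd : DenseRange A.domain.subtypeL := by
      simpa [DenseRange] using h.dense
    exact ⟨Φ.extendOfNorm A.domain.subtypeL, fun x hx =>
      LinearMap.extendOfNorm_eq hd ⟨_, hΦ⟩ ⟨x, hx⟩⟩
  rw [volterra, dif_pos hex]
  exact hex.choose_spec x hx

theorem norm_volterra_le (h : IsMiyadera T A C) (hF : StronglyCont F) {t K L : ℝ} (ht : 0 ≤ t)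
    (hK : ∀ s ∈ Icc 0 t, ‖F s‖ ≤ K) (hL0 : 0 ≤ L)
    (hL : ∀ x ∈ A.domain, (∫ s in (0 : ℝ)..t, ‖onDomain A C (T s x)‖) ≤ L * ‖x‖) :
    ‖volterra A C T F t‖ ≤ K * L := by
  have hK0 : 0 ≤ K := (norm_nonneg _).trans (hK 0 ⟨le_rfl, ht⟩)
  refine opNorm_le_of_dense h.dense _ (by positivity) fun x hx => ?_
  rw [h.volterra_apply hF ht hx]
  refine (h.norm_integral_le ht hx (w := fun _ => K) continuousOn_const
    (fun s hs => hK _ ⟨sub_nonneg.2 hs.2, by linarith [hs.1]⟩)).trans ?_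
  rw [intervalIntegral.integral_const_mul, mul_assoc]
  gcongr
  exact hL _ hx

/-- If `λ` is so large that the weighted Miyadera–Voigt estimate holds, then the Volterra operator
is a contraction for the norm `sup_t e^{-λt} ‖F t‖`. -/
theorem norm_volterra_le_exp (h : IsMiyadera T A C) (hF : StronglyCont F) {lam K : ℝ}
    (hlam : ∀ x ∈ A.domain, ∀ t, 0 ≤ t →
      (∫ s in (0 : ℝ)..t, Real.exp (-(lam * s)) * ‖onDomain A C (T s x)‖) ≤ 1 / 2 * ‖x‖)
    (hK : ∀ s, 0 ≤ s → ‖F s‖ ≤ K * Real.exp (lam * s)) {t : ℝ} (ht : 0 ≤ t) :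
    ‖volterra A C T F t‖ ≤ K / 2 * Real.exp (lam * t) := by
  have hK0 : 0 ≤ K := by simpa using (norm_nonneg _).trans (hK 0 le_rfl)
  refine opNorm_le_of_dense h.dense _ (by positivity) fun x hx => ?_
  rw [h.volterra_apply hF ht hx]
  refine (h.norm_integral_le ht hx
    (w := fun s => K * Real.exp (lam * t) * Real.exp (-(lam * s))) (by fun_prop)
    (fun s hs => ?_)).trans ?_
  · refine (hK _ (sub_nonneg.2 hs.2)).trans_eq ?_
    rw [mul_assoc, ← Real.exp_add]
    congr 2; ring
  · simp only [mul_assoc (K * Real.exp (lam * t))]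
    rw [intervalIntegral.integral_const_mul]
    calc _ ≤ K * Real.exp (lam * t) * (1 / 2 * ‖x‖) := by gcongr; exact hlam x hx t ht
      _ = _ := by ring

theorem volterra_sub (h : IsMiyadera T A C) (hF : StronglyCont F) (hG : StronglyCont G) {t : ℝ}
    (ht : 0 ≤ t) :
    volterra A C T (fun s => F s - G s) t = volterra A C T F t - volterra A C T G t := by
  refine eq_of_eqOn_dense h.dense fun x hx => ?_
  have hFG : StronglyCont (fun s => F s - G s) := fun x => (hF x).sub (hG x)
  rw [sub_apply, h.volterra_apply hFG ht hx, h.volterra_apply hF ht hx,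
    h.volterra_apply hG ht hx,
    ← intervalIntegral.integral_sub (h.intervalIntegrable_integrand hF ht hx)
      (h.intervalIntegrable_integrand hG ht hx)]
  rfl

theorem _root_.EvNormCont.StronglyCont.comp_add (hF : StronglyCont F) {b : ℝ} (hb : 0 ≤ b) :
    StronglyCont (fun s => F (s + b)) := fun x =>
  (hF x).comp (by fun_prop) fun _ hs => add_nonneg hs hb

/-- Splitting the Volterra integral over `[0, t + b]` at `t`. -/
theorem volterra_add (h : IsMiyadera T A C) (hF : StronglyCont F) {t b : ℝ} (ht : 0 ≤ t)
    (hb : 0 ≤ b) : volterra A C T F (t + b) =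
      volterra A C T (fun s => F (s + b)) t + (volterra A C T F b).comp (T t) := by
  refine eq_of_eqOn_dense h.dense fun x hx => ?_
  have hc := h.continuousOn_integrand hF (t + b) hx
  rw [add_apply, ContinuousLinearMap.comp_apply,
    h.volterra_apply hF (add_nonneg ht hb) hx, h.volterra_apply (hF.comp_add hb) ht hx,
    h.volterra_apply hF hb (h.apply_mem hx ht),
    ← intervalIntegral.integral_add_adjacent_intervals (b := t)
      ((hc.mono (Icc_subset_Icc_right (by linarith))).intervalIntegrable_of_Icc ht)
      ((hc.mono (Icc_subset_Icc_left ht)).intervalIntegrable_of_Icc (by linarith))]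
  congr 1
  · refine intervalIntegral.integral_congr fun s _ => ?_
    congr 2; ring
  · have e1 := intervalIntegral.integral_comp_add_right (a := 0) (b := b)
      (fun s => F (t + b - s) (onDomain A C (T s x))) t
    rw [zero_add, add_comm b t] at e1
    rw [← e1]
    refine intervalIntegral.integral_congr fun s hs => ?_
    rw [uIcc_of_le hb] at hs
    rw [h.orbit_add x hs.1 ht]
    congr 2; ring

theorem stronglyCont_volterra (h : IsMiyadera T A C) (hF : StronglyCont F) :
    StronglyCont (volterra A C T F) := by
  refine stronglyCont_of_dense h.dense (fun b => ?_) fun x hx => ?_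
  · obtain ⟨K, -, hK⟩ := hF.exists_bound b
    obtain ⟨L, hL0, hL⟩ := h.exists_integral_bound b
    exact ⟨K * L, fun t ht => h.norm_volterra_le hF ht.1
      (fun s hs => hK s ⟨hs.1, hs.2.trans ht.2⟩) hL0 fun x hx => hL x hx t ht⟩
  -- extending both factors constantly to negative times makes the integrand jointly continuous
  have hcont : Continuous (Function.uncurry fun t s : ℝ =>
      F (max (t - s) 0) (onDomain A C (T (max s 0) x))) := by
    rw [← continuousOn_univ]
    refine hF.continuousOn_apply (f := fun p : ℝ × ℝ => max (p.1 - p.2) 0) (by fun_prop)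
      (fun _ _ => le_max_right _ _) ?_
    exact (h.continuousOn_orbit hx).comp (f := fun p : ℝ × ℝ => max p.2 0) (by fun_prop)
      fun p _ => le_max_right p.2 0
  refine ((intervalIntegral.continuous_parametric_intervalIntegral_of_continuous (a₀ := 0)
    (μ := volume) hcont continuous_id).continuousOn (s := Ici 0)).congr fun t (ht : 0 ≤ t) => ?_
  rw [h.volterra_apply hF ht hx]
  refine intervalIntegral.integral_congr fun s hs => ?_
  replace hs : s ∈ uIcc 0 t := hs
  rw [uIcc_of_le ht] at hs
  rw [max_eq_left (sub_nonneg.2 hs.2), max_eq_left hs.1]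

theorem volterra_zero (h : IsMiyadera T A C) (hF : StronglyCont F) : volterra A C T F 0 = 0 := by
  refine eq_of_eqOn_dense h.dense fun x hx => ?_
  rw [h.volterra_apply hF le_rfl hx]
  simp

/-- The equation `F = V F` has only the zero solution among exponentially bounded functions. -/
theorem eq_zero_of_volterra_eq (h : IsMiyadera T A C) (hF : StronglyCont F) {lam K : ℝ}
    (hlam : ∀ x ∈ A.domain, ∀ t, 0 ≤ t →
      (∫ s in (0 : ℝ)..t, Real.exp (-(lam * s)) * ‖onDomain A C (T s x)‖) ≤ 1 / 2 * ‖x‖)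
    (hK : ∀ s, 0 ≤ s → ‖F s‖ ≤ K * Real.exp (lam * s))
    (hfix : ∀ t, 0 ≤ t → F t = volterra A C T F t) {t : ℝ} (ht : 0 ≤ t) : F t = 0 := by
  have key : ∀ n : ℕ, ∀ s, 0 ≤ s → ‖F s‖ ≤ K * (1 / 2) ^ n * Real.exp (lam * s) := by
    intro n
    induction n with
    | zero => simpa using hK
    | succ n ih =>
      intro s hs
      rw [hfix s hs]
      refine (h.norm_volterra_le_exp hF hlam ih hs).trans_eq ?_
      rw [pow_succ]; ring
  have hlim : Tendsto (fun n : ℕ => K * (1 / 2 : ℝ) ^ n * Real.exp (lam * t)) atTop (𝓝 0) := by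
    simpa using ((tendsto_pow_atTop_nhds_zero_of_lt_one (r := (1 / 2 : ℝ)) (by norm_num)
      (by norm_num)).const_mul K).mul_const (Real.exp (lam * t))
  exact norm_le_zero_iff.1 (ge_of_tendsto' hlim fun n => key n t ht)

end IsMiyadera

/-! ### The Dyson–Phillips series -/

/-- The sum `U(t) = ∑ₙ (Vⁿ T)(t)` of the Dyson–Phillips series. -/
noncomputable def dyson (A : X →ₗ.[𝕜] X) (C : A.domain →ₗ[𝕜] X) (T : ℝ → X →L[𝕜] X) (t : ℝ) :
    X →L[𝕜] X :=
  ∑' n : ℕ, (volterra A C T)^[n] T t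

namespace IsMiyadera

variable {T F : ℝ → X →L[𝕜] X} {A : X →ₗ.[𝕜] X} {C : A.domain →ₗ[𝕜] X}

theorem stronglyCont_iterate (h : IsMiyadera T A C) (n : ℕ) :
    StronglyCont ((volterra A C T)^[n] T) := by
  induction n with
  | zero => exact h.semigroup.stronglyCont
  | succ n ih =>
    rw [Function.iterate_succ_apply']
    exact h.stronglyCont_volterra ih

/-- Growth constants for the Dyson–Phillips series: the semigroup grows at most like `e^{λt}`, and
the weighted Miyadera–Voigt estimate holds for every exponent at least `λ`. -/
def GrowthBound (T : ℝ → X →L[𝕜] X) (A : X →ₗ.[𝕜] X) (C : A.domain →ₗ[𝕜] X) (M lam : ℝ) : Prop :=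
  0 ≤ M ∧ 0 ≤ lam ∧ (∀ t, 0 ≤ t → ‖T t‖ ≤ M * Real.exp (lam * t)) ∧
    ∀ mu, lam ≤ mu → ∀ x ∈ A.domain, ∀ t, 0 ≤ t →
      (∫ s in (0 : ℝ)..t, Real.exp (-(mu * s)) * ‖onDomain A C (T s x)‖) ≤ 1 / 2 * ‖x‖

theorem exists_growthBound (h : IsMiyadera T A C) : ∃ M lam, GrowthBound T A C M lam := by
  obtain ⟨M, ω, lam, hM1, hω, hlam, hM, hw⟩ := h.exists_weight
  refine ⟨M, lam, by linarith, by linarith, fun t ht => (hM t ht).trans ?_, hw⟩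
  gcongr

variable {M lam : ℝ}

theorem norm_iterate_le (h : IsMiyadera T A C) (hg : GrowthBound T A C M lam) (n : ℕ) {t : ℝ}
    (ht : 0 ≤ t) : ‖(volterra A C T)^[n] T t‖ ≤ M * Real.exp (lam * t) * (1 / 2) ^ n := by
  have key : ∀ t, 0 ≤ t →
      ‖(volterra A C T)^[n] T t‖ ≤ M * (1 / 2) ^ n * Real.exp (lam * t) := by
    induction n with
    | zero => simpa using hg.2.2.1
    | succ n ih =>
      intro t ht
      rw [Function.iterate_succ_apply']
      refine (h.norm_volterra_le_exp (h.stronglyCont_iterate n) (hg.2.2.2 lam le_rfl)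
        ih ht).trans_eq ?_
      rw [pow_succ]; ring
  refine (key t ht).trans_eq ?_
  ring

theorem hasSum_dyson (h : IsMiyadera T A C) {t : ℝ} (ht : 0 ≤ t) :
    HasSum (fun n => (volterra A C T)^[n] T t) (dyson A C T t) := by
  obtain ⟨M, lam, hg⟩ := h.exists_growthBound
  exact (Summable.of_norm_bounded (summable_geometric_two.mul_left _)
    fun n => h.norm_iterate_le hg n ht).hasSum

theorem norm_dyson_le (h : IsMiyadera T A C) (hg : GrowthBound T A C M lam) {t : ℝ}
    (ht : 0 ≤ t) : ‖dyson A C T t‖ ≤ 2 * M * Real.exp (lam * t) := by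
  refine (tsum_of_norm_bounded (hasSum_geometric_two.mul_left _)
    fun n => h.norm_iterate_le hg n ht).trans_eq ?_
  ring

/-- The Dyson–Phillips series converges uniformly on bounded intervals. -/
theorem norm_iterate_le_of_le (h : IsMiyadera T A C) (hg : GrowthBound T A C M lam) (n : ℕ)
    {t b : ℝ} (ht : 0 ≤ t) (htb : t ≤ b) :
    ‖(volterra A C T)^[n] T t‖ ≤ M * Real.exp (lam * b) * (1 / 2) ^ n := by
  refine (h.norm_iterate_le hg n ht).trans ?_
  have := hg.1
  have := hg.2.1
  gcongr

theorem continuousOn_dyson (h : IsMiyadera T A C) {S : Set ℝ} (hS : S ⊆ Ici 0)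
    (hc : ∀ n, ContinuousOn ((volterra A C T)^[n] T) S) : ContinuousOn (dyson A C T) S := by
  obtain ⟨M, lam, hg⟩ := h.exists_growthBound
  refine continuousOn_of_inter_Iic fun b => ?_
  exact continuousOn_tsum (fun n => (hc n).mono inter_subset_left)
    (summable_geometric_two.mul_left (M * Real.exp (lam * b)))
    fun n t ht => h.norm_iterate_le_of_le hg n (hS ht.1) ht.2

theorem stronglyCont_dyson (h : IsMiyadera T A C) : StronglyCont (dyson A C T) := by
  obtain ⟨M, lam, hg⟩ := h.exists_growthBound
  refine fun x => continuousOn_of_inter_Iic fun b => ?_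
  refine (continuousOn_tsum (f := fun n t => (volterra A C T)^[n] T t x)
    (fun n => (h.stronglyCont_iterate n x).mono inter_subset_left)
    ((summable_geometric_two.mul_left (M * Real.exp (lam * b))).mul_right ‖x‖)
    fun n t ht => ContinuousLinearMap.le_of_opNorm_le _
      (h.norm_iterate_le_of_le hg n ht.1 ht.2) x).congr fun t ht => ?_
  exact ((h.hasSum_dyson ht.1).mapL (ContinuousLinearMap.apply 𝕜 X x)).tsum_eq.symm

/-- The variation of parameters formula `U = T + V U`. -/
theorem dyson_eq (h : IsMiyadera T A C) {t : ℝ} (ht : 0 ≤ t) :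
    dyson A C T t = T t + volterra A C T (dyson A C T) t := by
  obtain ⟨M, lam, hg⟩ := h.exists_growthBound
  refine eq_of_eqOn_dense h.dense fun x hx => ?_
  have happ : ∀ s, 0 ≤ s → ∀ y, HasSum (fun n => (volterra A C T)^[n] T s y) (dyson A C T s y) :=
    fun s hs y => (h.hasSum_dyson hs).mapL (ContinuousLinearMap.apply 𝕜 X y)
  have hc : ContinuousOn (fun s => ‖onDomain A C (T s x)‖) (Icc 0 t) :=
    (h.continuousOn_orbit hx).norm.mono Icc_subset_Ici_self
  have hs1 : HasSum (fun n => ∫ s in (0 : ℝ)..t,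
      (volterra A C T)^[n] T (t - s) (onDomain A C (T s x)))
      (∫ s in (0 : ℝ)..t, dyson A C T (t - s) (onDomain A C (T s x))) := by
    refine intervalIntegral.hasSum_integral_of_dominated_convergence
      (fun n s => M * Real.exp (lam * t) * (1 / 2) ^ n * ‖onDomain A C (T s x)‖) (fun n => ?_)
      (fun n => Eventually.of_forall fun s hs => ?_) (Eventually.of_forall fun s _ => ?_) ?_
      (Eventually.of_forall fun s hs => ?_)
    · rw [uIoc_of_le ht]
      exact ((h.continuousOn_integrand (h.stronglyCont_iterate n) t hx).mono
        Ioc_subset_Icc_self).aestronglyMeasurable measurableSet_Ioc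
    · rw [uIoc_of_le ht] at hs
      exact ContinuousLinearMap.le_of_opNorm_le _ (h.norm_iterate_le_of_le hg n
        (sub_nonneg.2 hs.2) (by linarith [hs.1])) _
    · exact (summable_geometric_two.mul_left _).mul_right _
    · simp only [tsum_mul_right]
      exact (hc.const_mul _).intervalIntegrable_of_Icc ht
    · rw [uIoc_of_le ht] at hs
      exact happ _ (sub_nonneg.2 hs.2) _
  have hs2 := (hasSum_nat_add_iff' 1).2 (happ t ht x)
  have hs3 : HasSum (fun n => (volterra A C T)^[n + 1] T t x)
      (volterra A C T (dyson A C T) t x) := by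
    rw [h.volterra_apply h.stronglyCont_dyson ht hx]
    refine hs1.congr_fun fun n => ?_
    rw [Function.iterate_succ_apply', h.volterra_apply (h.stronglyCont_iterate n) ht hx]
  have := hs2.unique hs3
  rw [add_apply, ← this]
  simp

theorem comp_volterra (h : IsMiyadera T A C) (hF : StronglyCont F) (B : X →L[𝕜] X) {t : ℝ}
    (ht : 0 ≤ t) :
    B.comp (volterra A C T F t) = volterra A C T (fun s => B.comp (F s)) t := by
  have hBF : StronglyCont (fun s => B.comp (F s)) := fun x =>
    B.continuous.comp_continuousOn (hF x)
  refine eq_of_eqOn_dense h.dense fun x hx => ?_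
  rw [ContinuousLinearMap.comp_apply, h.volterra_apply hF ht hx, h.volterra_apply hBF ht hx,
    ← ContinuousLinearMap.intervalIntegral_comp_comm _ (h.intervalIntegrable_integrand hF ht hx)]
  rfl

/-- The Dyson–Phillips series is a semigroup: the defect `U(s + t) - U(t) U(s)`, as a function of
`s`, is a fixed point of the Volterra operator. -/
theorem isC0Semigroup_dyson (h : IsMiyadera T A C) : IsC0Semigroup (dyson A C T) := by
  obtain ⟨M, lam, hg⟩ := h.exists_growthBound
  have hU := h.stronglyCont_dyson
  refine ⟨?_, fun t s ht hs => ?_, hU⟩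
  · rw [h.dyson_eq le_rfl, h.volterra_zero hU, add_zero, h.semigroup.map_zero]
  have hU1 := hU.comp_add ht
  have hU2 : StronglyCont (fun s => (dyson A C T t).comp (dyson A C T s)) := fun x =>
    (dyson A C T t).continuous.comp_continuousOn (hU x)
  have hW : StronglyCont
      (fun s => dyson A C T (s + t) - (dyson A C T t).comp (dyson A C T s)) := fun x =>
    (hU1 x).sub (hU2 x)
  have hM := hg.1
  have hz := h.eq_zero_of_volterra_eq hW (hg.2.2.2 lam le_rfl)
    (K := 2 * M * Real.exp (lam * t) + 2 * M * Real.exp (lam * t) * (2 * M))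
    (fun r hr => ?_) (fun r hr => ?_) hs
  · rw [add_comm]
    exact sub_eq_zero.1 hz
  · refine (norm_sub_le _ _).trans ?_
    rw [add_mul]
    gcongr
    · refine (h.norm_dyson_le hg (add_nonneg hr ht)).trans_eq ?_
      rw [mul_add, Real.exp_add]; ring
    · refine (ContinuousLinearMap.opNorm_comp_le _ _).trans ?_
      rw [mul_assoc (2 * M * Real.exp (lam * t))]
      gcongr
      · exact h.norm_dyson_le hg ht
      · exact h.norm_dyson_le hg hr
  · rw [h.volterra_sub hU1 hU2 hr, ← h.comp_volterra hU _ hr, h.dyson_eq (add_nonneg hr ht),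
      h.volterra_add hU hr ht, add_comm r t, h.semigroup.map_add t r ht hr]
    have e1 := h.dyson_eq ht
    have e2 := h.dyson_eq hr
    calc _ = (T t + volterra A C T (dyson A C T) t).comp (T r) +
          volterra A C T (fun s => dyson A C T (s + t)) r -
          (dyson A C T t).comp (dyson A C T r) := by
          rw [ContinuousLinearMap.add_comp]; abel
      _ = (dyson A C T t).comp (T r) + volterra A C T (fun s => dyson A C T (s + t)) r -
          (dyson A C T t).comp (T r + volterra A C T (dyson A C T) r) := by rw [← e1, ← e2]
      _ = _ := by rw [ContinuousLinearMap.comp_add]; abel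

/-! ### The generator of the perturbed semigroup -/

theorem hasGen_dyson (h : IsMiyadera T A C) (x : A.domain) :
    HasGen (dyson A C T) x (A x + C x) := by
  have hU := h.stronglyCont_dyson
  have hav : Tendsto (fun r : ℝ => r⁻¹ • ∫ s in (0 : ℝ)..r,
      dyson A C T (r - s) (onDomain A C (T s x))) (𝓝[>] 0) (𝓝 (C x)) := by
    refine tendsto_average (φ := fun r s => dyson A C T (r - s) (onDomain A C (T s x))) ?_
      fun η hη => ?_
    · filter_upwards [self_mem_nhdsWithin] with r (hr : 0 < r)
      exact h.intervalIntegrable_integrand hU hr.le x.2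
    · have hc : ContinuousOn (fun p : ℝ × ℝ => dyson A C T (p.1 - p.2) (onDomain A C (T p.2 x)))
          {p | 0 ≤ p.2 ∧ p.2 ≤ p.1} :=
        hU.continuousOn_apply (by fun_prop) (fun p hp => sub_nonneg.2 hp.2)
          ((h.continuousOn_orbit x.2).comp continuousOn_snd fun p hp => hp.1)
      obtain ⟨δ, hδ, H⟩ := Metric.continuousOn_iff.1 hc (0, 0) ⟨le_rfl, le_rfl⟩ η hη
      filter_upwards [Ioo_mem_nhdsGT hδ] with r hr s hs
      have := H (r, s) ⟨hs.1, hs.2⟩ (by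
        rw [Prod.dist_eq, max_lt_iff]
        simp only [Real.dist_eq, sub_zero, abs_of_nonneg hs.1, abs_of_pos hr.1]
        exact ⟨hr.2, hs.2.trans_lt hr.2⟩)
      simp only [sub_zero, h.semigroup.apply_zero, h.isC0Semigroup_dyson.apply_zero,
        onDomain_of_mem A C x.2] at this
      rw [← dist_eq_norm]
      exact this.le
  refine ((h.generator.hasGen x).add hav).congr' ?_
  filter_upwards [self_mem_nhdsWithin] with r (hr : 0 < r)
  rw [h.dyson_eq hr.le, add_apply, h.volterra_apply hU hr.le x.2, ← smul_add]
  congr 1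
  abel

/-- The weighted Miyadera–Voigt estimate bounds `C R(λ, A)`, because
`C R(λ, A) x = ∫₀^∞ e^{-λs} C T(s) x ds` for `x ∈ D(A)`. -/
theorem norm_comp_resolvent_le (h : IsMiyadera T A C) {M ω lam : ℝ}
    (hM : ∀ t, 0 ≤ t → ‖T t‖ ≤ M * Real.exp (ω * t)) (hlam : ω < lam)
    (hw : ∀ x ∈ A.domain, ∀ t, 0 ≤ t →
      (∫ s in (0 : ℝ)..t, Real.exp (-(lam * s)) * ‖onDomain A C (T s x)‖) ≤ 1 / 2 * ‖x‖)
    {R P : X →L[𝕜] X} (hR : ∀ x, R x = ∫ s in Ioi (0 : ℝ), Real.exp (-(lam * s)) • T s x)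
    (hR2 : ∀ x y, HasGen T x y → R (lam • x - y) = x)
    (hR3 : ∀ t, 0 ≤ t → ∀ x, R (T t x) = T t (R x))
    (hP : ∀ x, P x = onDomain A C (R x)) : ‖P‖ ≤ 1 / 2 := by
  refine opNorm_le_of_dense h.dense _ (by norm_num) fun x hx => ?_
  have hz := hR2 x _ (h.generator.hasGen ⟨x, hx⟩)
  set z := lam • x - A ⟨x, hx⟩
  have hint := integrableOn_exp_smul_orbit h.semigroup hM hlam z
  have hPx : P x = ∫ s in Ioi (0 : ℝ), P (Real.exp (-(lam * s)) • T s z) := by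
    rw [ContinuousLinearMap.integral_comp_comm _ hint, ← hR, hz]
  have hlim := intervalIntegral_tendsto_integral_Ioi (0 : ℝ) (P.integrable_comp hint) tendsto_id
  rw [hPx]
  refine le_of_tendsto hlim.norm ?_
  filter_upwards [eventually_ge_atTop 0] with t ht
  refine (intervalIntegral.norm_integral_le_integral_norm ht).trans (le_trans (le_of_eq ?_)
    (hw x hx t ht))
  refine intervalIntegral.integral_congr fun s hs => ?_
  replace hs : s ∈ uIcc 0 t := hs
  rw [uIcc_of_le ht] at hs
  rw [ContinuousLinearMap.map_smul_of_tower, norm_smul, Real.norm_of_nonneg (Real.exp_pos _).le, hP,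
    hR3 s hs.1, hz]

/-- The Miyadera–Voigt perturbation theorem. The generator of the Dyson–Phillips series extends
`A + C`; there is equality since `λ - A - C = (1 - C R(λ, A)) (λ - A)` is onto for large `λ`. -/
theorem isGenerator_dyson (h : IsMiyadera T A C) :
    IsGenerator (perturb A C) (dyson A C T) := by
  intro x y
  change _ ↔ HasGen _ x y
  constructor
  · intro hxy
    obtain ⟨z, hz, hz'⟩ := (perturb A C).mem_graph_iff.1 hxy
    obtain rfl : (z : X) = x := hz
    obtain rfl : perturb A C z = y := hz'
    exact h.hasGen_dyson z
  intro hxy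
  obtain ⟨M, lam, hg⟩ := h.exists_growthBound
  obtain ⟨R, hR0, hR1, hR2, hR3⟩ := exists_resolvent h.semigroup hg.2.2.1 (lt_add_one lam)
  obtain ⟨P, hP⟩ := h.exists_comp_resolvent hR1
  have hPn : ‖P‖ < 1 := (h.norm_comp_resolvent_le hg.2.2.1 (lt_add_one lam)
    (hg.2.2.2 _ (lt_add_one lam).le) hR0 hR2 hR3 hP).trans_lt (by norm_num)
  obtain ⟨Q, -, -, hQ, -⟩ := exists_resolvent h.isC0Semigroup_dyson
    (fun t ht => h.norm_dyson_le hg ht) (lt_add_one lam)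
  obtain ⟨u, hu⟩ := isUnit_one_sub_of_norm_lt_one hPn
  set w := (lam + 1) • x - y with hw
  set z := (↑u⁻¹ : X →L[𝕜] X) w
  have hzw : z - P z = w := by
    have : ((1 : X →L[𝕜] X) - P) ((↑u⁻¹ : X →L[𝕜] X) w) = w := by
      rw [← hu, ← mul_apply_eq_comp, Units.mul_inv]; rfl
    simpa using this
  obtain ⟨hRz, hARz⟩ := h.generator.exists_of_hasGen (hR1 z)
  have hgen := h.hasGen_dyson ⟨R z, hRz⟩
  have hval : A ⟨R z, hRz⟩ + C ⟨R z, hRz⟩ = (lam + 1) • R z - w := by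
    rw [hARz, ← onDomain_of_mem A C hRz, ← hP, ← hzw]; abel
  have e1 := hQ _ _ hgen
  rw [hval, sub_sub_cancel] at e1
  have hx : x = R z := by rw [← hQ _ _ hxy]; exact e1
  refine (perturb A C).mem_graph_iff.2 ⟨⟨R z, hRz⟩, hx.symm, ?_⟩
  refine hval.trans ?_
  rw [← hx, hw, sub_sub_cancel]

end IsMiyadera

/-! ### Norm continuity -/

namespace IsMiyadera

variable {T F : ℝ → X →L[𝕜] X} {A : X →ₗ.[𝕜] X} {C : A.domain →ₗ[𝕜] X}

theorem exists_norm_volterra_le (h : IsMiyadera T A C) (hF : StronglyCont F) {η : ℝ}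
    (hη : 0 < η) : ∃ δ > 0, ∀ d ∈ Icc 0 δ, ‖volterra A C T F d‖ ≤ η := by
  obtain ⟨K, hK0, hK⟩ := hF.exists_bound 1
  obtain ⟨r, hr, hsmall⟩ := h.small (η / (K + 1)) (by positivity)
  refine ⟨min r 1, by positivity, fun d hd => ?_⟩
  refine (h.norm_volterra_le hF hd.1 (K := K) (L := η / (K + 1))
    (fun s hs => hK s ⟨hs.1, hs.2.trans (hd.2.trans (min_le_right _ _))⟩) (by positivity)
    fun x hx => (intervalIntegral.integral_mono_interval le_rfl hd.1
      (hd.2.trans (min_le_left _ _)) (Eventually.of_forall fun s => norm_nonneg _)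
      (h.intervalIntegrable_norm_orbit hx le_rfl hr.le)).trans (hsmall x hx)).trans ?_
  rw [mul_div_assoc', div_le_iff₀ (by positivity)]
  nlinarith

/-- `V F (t + d) - V F t = V (F(· + d) - F) t + (V F)(d) T(t)`, where the last term is small for
small `d` even if `T` is not continuous in norm. -/
theorem continuousOn_volterra_Ici (h : IsMiyadera T A C) (hF : StronglyCont F)
    (hc : ContinuousOn F (Ici 0)) : ContinuousOn (volterra A C T F) (Ici 0) := by
  refine continuousOn_of_inter_Iic fun b => ?_
  rw [Ici_inter_Iic]
  obtain ⟨N, hN0, hN⟩ := h.semigroup.stronglyCont.exists_bound b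
  obtain ⟨L, hL0, hL⟩ := h.exists_integral_bound b
  have huc := isCompact_Icc.uniformContinuousOn_of_continuous
    (hc.mono (Icc_subset_Ici_self : Icc 0 b ⊆ Ici 0))
  have key : ∀ η > 0, ∃ δ > 0, ∀ t ∈ Icc 0 b, ∀ t' ∈ Icc 0 b, t ≤ t' → t' - t < δ →
      ‖volterra A C T F t' - volterra A C T F t‖ < η := by
    intro η hη
    obtain ⟨δ₁, hδ₁, H₁⟩ := Metric.uniformContinuousOn_iff.1 huc (η / (3 * (L + 1)))
      (by positivity)
    obtain ⟨δ₂, hδ₂, H₂⟩ := h.exists_norm_volterra_le hF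
      (show 0 < η / (3 * (N + 1)) by positivity)
    refine ⟨min δ₁ δ₂, by positivity, fun t ht t' ht' htt' hd => ?_⟩
    have hd0 : 0 ≤ t' - t := sub_nonneg.2 htt'
    have hFd := hF.comp_add hd0
    have hFF : StronglyCont (fun s => F (s + (t' - t)) - F s) := fun x => (hFd x).sub (hF x)
    have e : volterra A C T F t' - volterra A C T F t =
        volterra A C T (fun s => F (s + (t' - t)) - F s) t +
          (volterra A C T F (t' - t)).comp (T t) := by
      rw [h.volterra_sub hFd hF ht.1, add_comm, ← add_sub_assoc, add_comm,
        ← h.volterra_add hF ht.1 hd0, add_sub_cancel]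
    have b1 : ‖volterra A C T (fun s => F (s + (t' - t)) - F s) t‖ ≤
        η / (3 * (L + 1)) * L := by
      refine h.norm_volterra_le hFF ht.1 (fun s hs => ?_) hL0 fun x hx => hL x hx t ht
      rw [← dist_eq_norm]
      refine (H₁ _ ⟨add_nonneg hs.1 hd0, by linarith [hs.2, ht'.2]⟩ _
        ⟨hs.1, hs.2.trans ht.2⟩ ?_).le
      rw [Real.dist_eq, add_sub_cancel_left, abs_of_nonneg hd0]
      exact hd.trans_le (min_le_left _ _)
    have b2 : ‖(volterra A C T F (t' - t)).comp (T t)‖ ≤ η / (3 * (N + 1)) * N := by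
      refine (ContinuousLinearMap.opNorm_comp_le _ _).trans ?_
      gcongr
      · exact H₂ _ ⟨hd0, hd.le.trans (min_le_right _ _)⟩
      · exact hN t ht
    have c1 : η / (3 * (L + 1)) * L ≤ η / 3 := by
      rw [div_mul_eq_mul_div, div_le_div_iff₀ (by positivity) (by positivity)]
      nlinarith
    have c2 : η / (3 * (N + 1)) * N ≤ η / 3 := by
      rw [div_mul_eq_mul_div, div_le_div_iff₀ (by positivity) (by positivity)]
      nlinarith
    rw [e]
    have := norm_add_le (volterra A C T (fun s => F (s + (t' - t)) - F s) t)
      ((volterra A C T F (t' - t)).comp (T t))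
    linarith
  refine Metric.continuousOn_iff.2 fun t ht η hη => ?_
  obtain ⟨δ, hδ, H⟩ := key η hη
  refine ⟨δ, hδ, fun t' ht' hd => ?_⟩
  rw [Real.dist_eq, abs_lt] at hd
  rcases le_total t t' with hle | hle
  · rw [dist_eq_norm]
    exact H t ht t' ht' hle hd.2
  · rw [dist_comm, dist_eq_norm]
    exact H t' ht' t ht hle (by linarith [hd.1])

/-- Norm continuity of `F` away from `0` is enough: `V F` is the locally uniform limit, as `δ ↘ 0`,
of the functions `t ↦ V (F(· + δ)) (t - δ)`. -/
theorem continuousOn_volterra_Ioi_zero (h : IsMiyadera T A C) (hF : StronglyCont F)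
    (hc : ContinuousOn F (Ioi 0)) : ContinuousOn (volterra A C T F) (Ioi 0) := by
  intro t₀ (ht₀ : 0 < t₀)
  refine ContinuousWithinAt.mono_of_mem_nhdsWithin (t := Icc (t₀ / 2) (t₀ + 1)) ?_
    (mem_nhdsWithin_of_mem_nhds (Icc_mem_nhds (by linarith) (by linarith)))
  refine (?_ : ContinuousOn (volterra A C T F) (Icc (t₀ / 2) (t₀ + 1))) t₀
    ⟨by linarith, by linarith⟩
  obtain ⟨N, hN0, hN⟩ := h.semigroup.stronglyCont.exists_bound (t₀ + 1)
  refine continuousOn_of_uniform_approx_of_continuousOn fun u hu => ?_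
  obtain ⟨η, hη, hηu⟩ := Metric.mem_uniformity_dist.1 hu
  obtain ⟨δ₁, hδ₁, H⟩ := h.exists_norm_volterra_le hF (show 0 < η / (N + 1) by positivity)
  obtain ⟨δ, hδ0, hδ1, hδ2⟩ : ∃ δ, 0 < δ ∧ δ ≤ δ₁ ∧ δ ≤ t₀ / 2 :=
    ⟨min δ₁ (t₀ / 2), by positivity, min_le_left _ _, min_le_right _ _⟩
  have hFc : ContinuousOn (fun s => F (s + δ)) (Ici 0) :=
    hc.comp (by fun_prop) fun s (hs : 0 ≤ s) => by
      have : 0 < s + δ := by linarith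
      exact this
  refine ⟨fun t => volterra A C T (fun s => F (s + δ)) (t - δ),
    (h.continuousOn_volterra_Ici (hF.comp_add hδ0.le) hFc).comp (by fun_prop)
      fun t ht => sub_nonneg.2 (hδ2.trans ht.1), fun t ht => hηu ?_⟩
  have htδ : 0 ≤ t - δ := sub_nonneg.2 (hδ2.trans ht.1)
  have e := h.volterra_add hF htδ hδ0.le
  rw [sub_add_cancel] at e
  rw [dist_eq_norm, e, add_sub_cancel_left]
  calc ‖(volterra A C T F δ).comp (T (t - δ))‖ ≤ η / (N + 1) * N := by
        refine (ContinuousLinearMap.opNorm_comp_le _ _).trans ?_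
        gcongr
        · exact H δ ⟨hδ0.le, hδ1⟩
        · exact hN _ ⟨htδ, by linarith [ht.2]⟩
    _ < η := by
        rw [div_mul_eq_mul_div, div_lt_iff₀ (by positivity)]
        nlinarith

/-- If `F` is norm continuous beyond `β` and `T` beyond `α`, then `V F` is norm continuous beyond
`β + α`, because `V F (t) = V (F(· + β)) (t - β) + (V F)(β) T(t - β)`. -/
theorem continuousOn_volterra_Ioi (h : IsMiyadera T A C) (hF : StronglyCont F) {α β : ℝ}
    (hα : 0 ≤ α) (hβ : 0 ≤ β) (hTc : ContinuousOn T (Ioi α)) (hFc : ContinuousOn F (Ioi β)) :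
    ContinuousOn (volterra A C T F) (Ioi (β + α)) := by
  have h1 : ContinuousOn (volterra A C T (fun s => F (s + β))) (Ioi 0) :=
    h.continuousOn_volterra_Ioi_zero (hF.comp_add hβ)
      (hFc.comp (by fun_prop) fun s (hs : 0 < s) => lt_add_of_pos_left β hs)
  have h2 : ContinuousOn (fun t => volterra A C T (fun s => F (s + β)) (t - β) +
      (volterra A C T F β).comp (T (t - β))) (Ioi (β + α)) := by
    refine (h1.comp (by fun_prop) fun t (ht : β + α < t) => ?_).add
      (continuousOn_const.clm_comp (hTc.comp (by fun_prop) fun t (ht : β + α < t) => ?_))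
    · show 0 < t - β
      linarith
    · show α < t - β
      linarith
  refine h2.congr fun t (ht : β + α < t) => ?_
  have e := h.volterra_add hF (t := t - β) (by linarith) hβ
  rwa [sub_add_cancel] at e

/-- Each application of `V` costs at most another `α` in norm continuity. -/
theorem continuousOn_iterate (h : IsMiyadera T A C) {α : ℝ} (hα : 0 ≤ α)
    (hTc : ContinuousOn T (Ioi α)) (k : ℕ) :
    ContinuousOn ((volterra A C T)^[k] T) (Ioi ((k + 1 : ℕ) * α)) := by
  induction k with
  | zero => simpa using hTc
  | succ k ih =>
    rw [Function.iterate_succ_apply']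
    have := h.continuousOn_volterra_Ioi (h.stronglyCont_iterate k) hα (by positivity) hTc ih
    refine this.mono (Ioi_subset_Ioi (le_of_eq ?_))
    push_cast; ring

/-- Norm continuity on the whole of `(0, ∞)` is inherited by all later terms of the series. -/
theorem continuousOn_iterate_of_le (h : IsMiyadera T A C) {n : ℕ}
    (hn : ContinuousOn ((volterra A C T)^[n] T) (Ioi 0)) {k : ℕ} (hk : n ≤ k) :
    ContinuousOn ((volterra A C T)^[k] T) (Ioi 0) := by
  induction k, hk using Nat.le_induction with
  | base => exact hn
  | succ k _ ih =>
    rw [Function.iterate_succ_apply']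
    exact h.continuousOn_volterra_Ioi_zero (h.stronglyCont_iterate k) ih

theorem continuousOn_dyson_Ioi (h : IsMiyadera T A C) {α : ℝ} (hα : 0 ≤ α)
    (hTc : ContinuousOn T (Ioi α)) {n : ℕ}
    (hn : ContinuousOn ((volterra A C T)^[n] T) (Ioi 0)) :
    ContinuousOn (dyson A C T) (Ioi (n * α)) := by
  have hnα : 0 ≤ n * α := by positivity
  refine h.continuousOn_dyson (fun t (ht : n * α < t) => hnα.trans ht.le) fun k => ?_
  rcases le_or_gt n k with hk | hk
  · exact (h.continuousOn_iterate_of_le hn hk).mono (Ioi_subset_Ioi hnα)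
  · refine (h.continuousOn_iterate hα hTc k).mono (Ioi_subset_Ioi ?_)
    have : k + 1 ≤ n := hk
    gcongr

end IsMiyadera
end EvNormCont

theorem theorem5p1 {𝕜 X : Type*} [RCLike 𝕜] [NormedAddCommGroup X] [NormedSpace 𝕜 X]
    [NormedSpace ℝ X] [IsScalarTower ℝ 𝕜 X] [CompleteSpace X]
    (T : ℝ → X →L[𝕜] X) (hT : EvNormCont.IsC0Semigroup T)
    (A : X →ₗ.[𝕜] X) (hA : EvNormCont.IsGenerator A T)
    (C : A.domain →ₗ[𝕜] X) (hC : EvNormCont.IsGraphBounded A C)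
    (ε : ℝ) (hε : 0 < ε) (q : ℝ → ℝ) (hq_nonneg : ∀ t ∈ Ioo 0 ε, 0 ≤ q t)
    (hq : Tendsto q (𝓝[>] 0) (𝓝 0))
    (hM : ∀ x ∈ A.domain, ∀ t ∈ Ioo 0 ε,
      (∫ s in (0 : ℝ)..t, ‖EvNormCont.onDomain A C (T s x)‖) ≤ q t * ‖x‖) :
    (∃ U : ℝ → X →L[𝕜] X,
      EvNormCont.IsC0Semigroup U ∧ EvNormCont.IsGenerator (EvNormCont.perturb A C) U) ∧
    ∀ U : ℝ → X →L[𝕜] X,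
      EvNormCont.IsC0Semigroup U → EvNormCont.IsGenerator (EvNormCont.perturb A C) U →
        ∀ (α : ℝ) (n : ℕ), 0 ≤ α → ContinuousOn T (Ioi α) →
          ContinuousOn ((EvNormCont.volterra A C T)^[n] T) (Ioi 0) →
            ContinuousOn U (Ioi ((n : ℝ) * α)) := by
  have h : EvNormCont.IsMiyadera T A C := by
    refine ⟨hT, hA, hC, fun η hη => ?_⟩
    obtain ⟨t, hqt, ht⟩ :=
      ((hq.eventually (ge_mem_nhds hη)).and (Ioo_mem_nhdsGT hε)).exists
    refine ⟨t, ht.1, fun x hx => (hM x hx t ht).trans ?_⟩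
    gcongr
  refine ⟨⟨_, h.isC0Semigroup_dyson, h.isGenerator_dyson⟩,
    fun U hU hUgen α n hα hTc hn => (h.continuousOn_dyson_Ioi hα hTc hn).congr fun t ht => ?_⟩
  have hnα : 0 ≤ n * α := by positivity
  exact EvNormCont.eq_of_isGenerator hU h.isC0Semigroup_dyson hUgen h.isGenerator_dyson
    (hnα.trans (le_of_lt ht))
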